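/- Let $G=(V,E)$ be a finite undirected graph with edge costs $c_e\ge 0$, and let $(s_i,t_i)$, $i\in\iota$, be finitely many pairs of vertices with penalties $\pi_i\ge 0$. For an instance of prize-collecting Steiner forest, the cost of a forest $F\subseteq E$ is its length $\mathrm{Length}(F)=\sum_{e\in F}c_e$ plus the sum of the penalties of the pairs that $F$ does not connect, and the optimum is the least cost of a forest. Let $\varepsilon>0$. (1) Let $F$ be the forest returned by the algorithm Primal-Dual Forest on the instance with the penalties $\pi_i'=2\pi_i/\varepsilon$. This algorithm starts with every vertex as a component; the components $\{s_i\},\{t_i\}$ are active, and every terminal $s_i$, $t_i$ is alive and contributes $\pi_i'/2$ to the potential of its vertex. While there is an active component, the growth $y(S)$ and the uncharged growth of all active components $S$ are raised uniformly, and their potentials lowered at the same rate, until either an active component has potential $0$, or an edge $e$ between two distinct components, at least one of them active, is tight, i.e. $\sum_{S:\,e\in\delta(S)}y(S)=c_e$. In the first case the component becomes inactive, and all terminals in it that are alive are marked dead and their histories are processed. In the second case $e$ is added to the forest and the two components are replaced by their union $S$, which is active with growth $0$, uncharged growth $0$ and the sum of the two potentials; for every pair $i$ that has one terminal in each of the two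 components, the history of each of $s_i,t_i$ that is alive is processed and the result is subtracted from the potential of $S$, and both are marked satisfied if both were alive, and dead otherwise. To process the history of a terminal of pair $i$ is to run, in increasing order of size, through the components that contained it and after whose formation it was alive, paying from a budget of $\pi_i'/2$ for their uncharged growth (setting it to $0$) as long as the budget suffices; the first component for which it does not suffice has its uncharged growth reduced by the rest of the budget, and then the result is $0$; if there is none, the result is the rest of the budget. Finally, the edges of the forest are considered one by one, and each is deleted if this separates no pair of satisfied terminals. (2) Contract each tree $T_a$ of $F$ to a vertex $v_a$, which gives a multigraph $\hat G$; give $v_a$ the potential $\frac1\varepsilon\mathrm{Length}(T_a)$, and every other vertex of $\hat G$ the potential $0$. Run the prize-collecting clustering algorithm on $\hat G$: every vertex is initially an active component with its potential; as long as there is an active component, the growth $y(S)$ of all active components is raised uniformly, and their potentials lowered at the same rate, until an active component has potential $0$, and becomes inactive, or an edge between two distinct components, at least one of them active, is tight, and is selected; then the two components are replaced by their union, which is active, with the sum of the potentials. Let $F_1$ be the set of selected edges. As long as there is a component $S$ that became inactive at some time such that exactly one of the remaining edges of $F_1$ lies in $\delta(S)$, delete that edge. Let $F_2$ be the set of remaining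 edges, and let $\mathcal T^1,\mathcal T^2,\dots$ be the trees of the forest $F_2$ in $\hat G$ (single vertices included). (3) Let $I^j$ be the instance on $G$ with the same edge costs in which the penalty of pair $i$ is $\pi_i$ if the vertices of $\hat G$ that $s_i$ and $t_i$ are contracted to both lie in $\mathcal T^j$, and $0$ otherwise, and let $\mathrm{OPT}^j$ be its optimum. Let $F^*$ be a solution of the original instance that pays the penalty of every pair separated by $F$, that is, a forest in $G$ together with a set $P$ of paid pairs that contains all pairs not connected by this forest and all pairs not connected by $F$; its cost is $\mathrm{Cost}(F^*)=\mathrm{Length}(F^*)+\sum_{i\in P}\pi_i$. Then, for every way of breaking ties in the two algorithms, $$\sum_j \mathrm{OPT}^j\le(1+\varepsilon)\,\mathrm{Cost}(F^*).$$ -/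

import Mathlib

open scoped Classical

noncomputable section

/-! ## Finite multigraphs with edge costs, and prize-collecting Steiner forest -/

/-- An undirected multigraph with vertex set `V` and edge set `E` (parallel edges and loops are
allowed, since contraction creates them), with a real cost on every edge. -/
structure CostGraph (V E : Type*) where
  ends : E → Sym2 V
  cost : E → ℝ

namespace CostGraph

variable {V E : Type*} (G : CostGraph V E)

/-- The graph `(V, F)`, with parallel edges identified and loops dropped. It is used only to speak
about reachability and connected components. -/
def span (F : Finset E) : SimpleGraph V :=
  SimpleGraph.fromRel fun u v => ∃ e ∈ F, G.ends e = s(u, v)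

/-- `F` is (the edge set of) a forest: no edge of `F` has its two ends connected by the other edges
of `F`. This excludes loops and pairs of parallel edges too. -/
def IsForest (F : Finset E) : Prop :=
  ∀ e ∈ F, ∀ u v, G.ends e = s(u, v) → ¬ (G.span (F.erase e)).Reachable u v

/-- Total cost of the edges of `F`. -/
def length (F : Finset E) : ℝ := ∑ e ∈ F, G.cost e

/-- `e` has one end in `S₁` and the other in `S₂`. -/
def Joins (e : E) (S₁ S₂ : Finset V) : Prop :=
  ∃ u ∈ S₁, ∃ v ∈ S₂, G.ends e = s(u, v)

/-- `e ∈ δ(S)`: exactly one end of `e` lies in `S`. -/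
def Crosses (e : E) (S : Finset V) : Prop :=
  ∃ u ∈ S, ∃ v ∉ S, G.ends e = s(u, v)

/-- The total dual value `∑_{S : e ∈ δ(S)} y(S)` that loads the edge `e`. -/
def load [Fintype V] (y : Finset V → ℝ) (e : E) : ℝ :=
  ∑ S : Finset V with G.Crosses e S, y S

/-- The graph obtained by contracting every connected component of `(V, F)` to one vertex. Edges
inside a component stay as loops; these never join two components and never cross a set. -/
def contract (F : Finset E) : CostGraph (G.span F).ConnectedComponent E where
  ends e := (G.ends e).map (G.span F).connectedComponentMk
  cost := G.cost

/-- The edges of `F` that lie in the component `K` of `(V, F)`. -/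
def treeEdges (F : Finset E) (K : (G.span F).ConnectedComponent) : Finset E :=
  {e ∈ F | ∀ u ∈ G.ends e, (G.span F).connectedComponentMk u = K}

end CostGraph

/-- An instance of prize-collecting Steiner forest: a graph with edge costs, and pairs
`(s i, t i)`, `i ∈ ι`, with penalties. -/
structure PCSF (V E ι : Type*) extends CostGraph V E where
  s : ι → V
  t : ι → V
  penalty : ι → ℝ

namespace PCSF

variable {V E ι : Type*} (I : PCSF V E ι)

/-- `F` connects the pair `i`. -/
def Connects (F : Finset E) (i : ι) : Prop := (I.span F).Reachable (I.s i) (I.t i)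

/-- Length of `F` plus the penalties of the pairs that `F` does not connect. -/
def totalCost [Fintype ι] (F : Finset E) : ℝ :=
  I.length F + ∑ i with ¬ I.Connects F i, I.penalty i

/-- The optimal cost of the instance: the least cost of a forest. -/
def opt [Fintype ι] : ℝ := sInf {x | ∃ F : Finset E, I.IsForest F ∧ x = I.totalCost F}

/-- A solution that says explicitly for which pairs it pays: `F` is a forest, and all pairs outside
`paid` are connected by `F`. (It is allowed to pay for a pair that `F` happens to connect.) -/
def IsPayingSolution (F : Finset E) (paid : Finset ι) : Prop :=
  I.IsForest F ∧ ∀ i, ¬ I.Connects F i → i ∈ paid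

/-- The cost of such a solution. -/
def payingCost (F : Finset E) (paid : Finset ι) : ℝ :=
  I.length F + ∑ i ∈ paid, I.penalty i

/-- The instance with all penalties multiplied by `k`. -/
def scale (k : ℝ) : PCSF V E ι := { I with penalty := fun i => k * I.penalty i }

/-- The instance in which the penalties of the pairs not satisfying `p` are set to zero. -/
def restrict (p : ι → Prop) : PCSF V E ι :=
  { I with penalty := fun i => if p i then I.penalty i else 0 }

end PCSF

/-! ## Moat growing: the part that the two primal-dual algorithms share -/

/-- Forest chosen so far, its components, the active components, the growth `y(S)` of the
components formed so far, and the remaining potentials. -/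
structure GrowState (V E : Type*) where
  forest : Finset E
  comps : Finset (Finset V)
  active : Finset (Finset V)
  y : Finset V → ℝ
  pot : Finset V → ℝ

namespace GrowState

variable {V E : Type*}

/-- Grow every active component by `Δ`, at the expense of its potential. -/
def grow (σ : GrowState V E) (Δ : ℝ) : GrowState V E :=
  { σ with
    y := fun S => if S ∈ σ.active then σ.y S + Δ else σ.y S
    pot := fun S => if S ∈ σ.active then σ.pot S - Δ else σ.pot S }

/-- Add `e` to the forest and replace the components `S₁`, `S₂` by their union, which is active and
gets the sum of their potentials. -/
def merge (σ : GrowState V E) (e : E) (S₁ S₂ : Finset V) : GrowState V E where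
  forest := insert e σ.forest
  comps := insert (S₁ ∪ S₂) (σ.comps \ {S₁, S₂})
  active := insert (S₁ ∪ S₂) (σ.active \ {S₁, S₂})
  y := Function.update σ.y (S₁ ∪ S₂) 0
  pot := Function.update σ.pot (S₁ ∪ S₂) (σ.pot S₁ + σ.pot S₂)

/-- Mark `S` as inactive. -/
def deactivate (σ : GrowState V E) (S : Finset V) : GrowState V E :=
  { σ with active := σ.active.erase S }

variable [Fintype V]

/-- No edge is overloaded and no active component has overdrawn its potential. -/
def Feasible (G : CostGraph V E) (σ : GrowState V E) : Prop :=
  (∀ e, G.load σ.y e ≤ G.cost e) ∧ ∀ S ∈ σ.active, 0 ≤ σ.pot S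

/-- `e` is a tight edge between two distinct current components, at least one of them active. -/
def EdgeEvent (G : CostGraph V E) (σ : GrowState V E) (e : E) (S₁ S₂ : Finset V) : Prop :=
  S₁ ∈ σ.comps ∧ S₂ ∈ σ.comps ∧ S₁ ≠ S₂ ∧ (S₁ ∈ σ.active ∨ S₂ ∈ σ.active) ∧
    G.Joins e S₁ S₂ ∧ G.load σ.y e = G.cost e

/-- The active component `S` has used all its potential. -/
def SpentEvent (σ : GrowState V E) (S : Finset V) : Prop :=
  S ∈ σ.active ∧ σ.pot S = 0

end GrowState

/-! ## The primal-dual algorithm for prize-collecting Steiner forest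

In both algorithms below one iteration grows all active components by an amount `Δ ≥ 0` that keeps
everything feasible and at which an event occurs (this makes `Δ` the largest feasible amount), and
then handles one event. Simultaneous events are handled one after the other, with `Δ = 0`; every
way to break ties, and every order in which a loop may run through a set, is allowed. -/

namespace PrimalDual

/-- Label of a terminal. -/
inductive Status where
  | alive
  | satisfied
  | dead

/-- The state of the algorithm. The terminals are indexed by `ι × Bool`: `(i, false)` stands for
`s i`, and `(i, true)` for `t i`. The field `dual` holds the variables `y_{i,S}`; `history a` lists
the components that contained the terminal `a` and after whose formation `a` was alive, in the
order of their formation, which is the increasing order of size. -/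
structure State (V E ι : Type*) where
  core : GrowState V E
  uncharged : Finset V → ℝ
  dual : ι → Finset V → ℝ
  status : ι × Bool → Status
  history : ι × Bool → List (Finset V)

variable {V E ι : Type*} (I : PCSF V E ι)

/-- The vertex of a terminal. -/
def loc (a : ι × Bool) : V := if a.2 then I.t a.1 else I.s a.1

/-- Initially every vertex is a component, those of the terminals are active, and each terminal
contributes half of the penalty of its pair to the potential of its vertex. -/
def init [Fintype V] [Fintype ι] : State V E ι where
  core :=
    { forest := ∅
      comps := Finset.univ.image fun v => {v}
      active := Finset.univ.image fun a => {loc I a}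
      y := fun _ => 0
      pot := fun S => ∑ a : ι × Bool with {loc I a} = S, I.penalty a.1 / 2 }
  uncharged := fun _ => 0
  dual := fun _ _ => 0
  status := fun _ => .alive
  history := fun a => [{loc I a}]

/-- Increase `y` and the uncharged growth of all active components by `Δ`. -/
def grow (σ : State V E ι) (Δ : ℝ) : State V E ι :=
  { σ with
    core := σ.core.grow Δ
    uncharged := fun S => if S ∈ σ.core.active then σ.uncharged S + Δ else σ.uncharged S }

/-- Charge the uncharged growth of the listed components to pair `i`, as long as the remaining
charge `r` lasts; return what is left of `r`, and the new state. -/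
def charge (i : ι) : List (Finset V) → ℝ → State V E ι → ℝ × State V E ι
  | [], r, σ => (r, σ)
  | S :: L, r, σ =>
    if σ.uncharged S ≤ r then
      charge i L (r - σ.uncharged S)
        { σ with
          dual := Function.update σ.dual i (Function.update (σ.dual i) S (σ.uncharged S))
          uncharged := Function.update σ.uncharged S 0 }
    else
      (0, { σ with
            dual := Function.update σ.dual i (Function.update (σ.dual i) S r)
            uncharged := Function.update σ.uncharged S (σ.uncharged S - r) })

/-- The procedure ProcessHistory for the terminal `a`. -/
def processHistory (a : ι × Bool) (σ : State V E ι) : ℝ × State V E ι :=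
  charge a.1 (σ.history a) (I.penalty a.1 / 2) σ

/-- If the terminal `a` is alive, process its history and subtract the result from the potential
of `S`. -/
def settle (S : Finset V) (a : ι × Bool) (σ : State V E ι) : State V E ι :=
  match σ.status a with
  | .alive =>
    let p := processHistory I a σ
    { p.2 with
      core := { p.2.core with
                pot := Function.update p.2.core.pot S (p.2.core.pot S - p.1) } }
  | _ => σ

/-- The treatment of a pair `i` that has just been united by the new component `S`. -/
def unite (S : Finset V) (σ : State V E ι) (i : ι) : State V E ι :=
  let τ := settle I S (i, true) (settle I S (i, false) σ)
  let new : Status :=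
    if σ.status (i, false) = .alive ∧ σ.status (i, true) = .alive then .satisfied else .dead
  { τ with status := Function.update (Function.update τ.status (i, false) new) (i, true) new }

/-- The pair `i` lies in the union of the disjoint components `S₁`, `S₂`, but in none of them. -/
def United (S₁ S₂ : Finset V) (i : ι) : Prop :=
  (I.s i ∈ S₁ ∧ I.t i ∈ S₂) ∨ (I.s i ∈ S₂ ∧ I.t i ∈ S₁)

/-- Merge `S₁` and `S₂` along `e`, and treat the united pairs in the order of the list `l`. At the
end the new component enters the histories of the terminals in it that are still alive. -/
def merge (σ : State V E ι) (e : E) (S₁ S₂ : Finset V) (l : List ι) : State V E ι :=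
  let S := S₁ ∪ S₂
  let τ := l.foldl (unite I S)
    { σ with
      core := σ.core.merge e S₁ S₂
      uncharged := Function.update σ.uncharged S 0 }
  { τ with
    history := fun a =>
      if loc I a ∈ S ∧ τ.status a = .alive then τ.history a ++ [S] else τ.history a }

/-- Mark the terminal `a` as dead and process its history. -/
def kill (σ : State V E ι) (a : ι × Bool) : State V E ι :=
  (processHistory I a { σ with status := Function.update σ.status a .dead }).2

/-- Deactivate `S`, and kill the terminals in the list `l`. -/
def deactivate (σ : State V E ι) (S : Finset V) (l : List (ι × Bool)) : State V E ι :=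
  l.foldl (kill I) { σ with core := σ.core.deactivate S }

/-- One iteration of the main loop. -/
inductive Step [Fintype V] : State V E ι → State V E ι → Prop
  | merge (σ : State V E ι) (Δ : ℝ) (e : E) (S₁ S₂ : Finset V) (l : List ι) :
      0 ≤ Δ → (σ.core.grow Δ).Feasible I.toCostGraph →
      (σ.core.grow Δ).EdgeEvent I.toCostGraph e S₁ S₂ →
      l.Nodup → (∀ i, i ∈ l ↔ United I S₁ S₂ i) →
      Step σ (merge I (grow σ Δ) e S₁ S₂ l)
  | deactivate (σ : State V E ι) (Δ : ℝ) (S : Finset V) (l : List (ι × Bool)) :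
      0 ≤ Δ → (σ.core.grow Δ).Feasible I.toCostGraph →
      (σ.core.grow Δ).SpentEvent S →
      l.Nodup → (∀ a, a ∈ l ↔ loc I a ∈ S ∧ σ.status a = .alive) →
      Step σ (deactivate I (grow σ Δ) S l)

/-- One step of the deletion phase: delete `e` from `F` if afterwards no pair of satisfied
terminals is separated. -/
def prune (status : ι × Bool → Status) (F : Finset E) (e : E) : Finset E :=
  if ∀ i, status (i, false) = .satisfied → status (i, true) = .satisfied →
      I.Connects (F.erase e) i
  then F.erase e else F

/-- `F` is the forest returned by some run of the algorithm on the instance `I`: the main loop runs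
until no component is active; then the deletion phase goes once through all edges of the forest
that has been grown. -/
def Output [Fintype V] [Fintype ι] (F : Finset E) : Prop :=
  ∃ σ : State V E ι, Relation.ReflTransGen (Step I) (init I) σ ∧ σ.core.active = ∅ ∧
    ∃ l : List E, l.Nodup ∧ (∀ e, e ∈ l ↔ e ∈ σ.core.forest) ∧
      F = l.foldl (prune I σ.status) σ.core.forest

end PrimalDual

/-! ## Prize-collecting clustering -/

namespace Clustering

/-- The state of the first stage: the moats, and the components that have become inactive at some
time so far. -/
structure State (V E : Type*) where
  core : GrowState V E
  inactive : Finset (Finset V)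

variable {V E : Type*} [Fintype V]

/-- Initially every vertex is an active component with its own potential. -/
def init (φ : V → ℝ) : State V E where
  core :=
    { forest := ∅
      comps := Finset.univ.image fun v => {v}
      active := Finset.univ.image fun v => {v}
      y := fun _ => 0
      pot := fun S => ∑ v with {v} = S, φ v }
  inactive := ∅

/-- One iteration of the first stage. -/
inductive Step (G : CostGraph V E) : State V E → State V E → Prop
  | merge (σ : State V E) (Δ : ℝ) (e : E) (S₁ S₂ : Finset V) :
      0 ≤ Δ → (σ.core.grow Δ).Feasible G → (σ.core.grow Δ).EdgeEvent G e S₁ S₂ →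
      Step G σ { σ with core := (σ.core.grow Δ).merge e S₁ S₂ }
  | deactivate (σ : State V E) (Δ : ℝ) (S : Finset V) :
      0 ≤ Δ → (σ.core.grow Δ).Feasible G → (σ.core.grow Δ).SpentEvent S →
      Step G σ { core := (σ.core.grow Δ).deactivate S, inactive := insert S σ.inactive }

/-- One step of the second stage: delete an edge that is the unique edge of the current forest
incident to some component from the family `B`. -/
def PruneStep (G : CostGraph V E) (B : Finset (Finset V)) (F F' : Finset E) : Prop :=
  ∃ S ∈ B, ∃ e, {f ∈ F | G.Crosses f S} = {e} ∧ F' = F.erase e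

/-- `F₂` is the forest returned by some run of the clustering algorithm with potentials `φ`: the
first stage runs until no component is active; the second stage deletes edges as long as there is
an edge to delete. -/
def Output (G : CostGraph V E) (φ : V → ℝ) (F₂ : Finset E) : Prop :=
  ∃ σ : State V E, Relation.ReflTransGen (Step G) (init φ) σ ∧ σ.core.active = ∅ ∧
    Relation.ReflTransGen (PruneStep G σ.inactive) σ.core.forest F₂ ∧
    ∀ F', ¬ PruneStep G σ.inactive F₂ F'

end Clustering

/-! ## The instances given by the clusters -/

namespace PCSF

variable {V E ι : Type*} (I : PCSF V E ι)

/-- The potential of the vertex that a tree of `F` is contracted to: the length of that tree,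
divided by `ε`. It is zero at a vertex that lies on no edge of `F`. -/
def treePotential (ε : ℝ) (F : Finset E) (K : (I.span F).ConnectedComponent) : ℝ :=
  1 / ε * I.length (I.treeEdges F K)

/-- The trees of `F₂`, a forest in the graph obtained from `I` by contracting the trees of `F`. A
tree may consist of a single vertex of the contracted graph. -/
abbrev Cluster (F F₂ : Finset E) : Type _ :=
  ((I.contract F).span F₂).ConnectedComponent

/-- The cluster in which a vertex of the original graph ends up. -/
def clusterOf (F F₂ : Finset E) (v : V) : I.Cluster F F₂ :=
  ((I.contract F).span F₂).connectedComponentMk ((I.span F).connectedComponentMk v)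

/-- The instance on the original graph that keeps the penalties of the pairs inside the cluster
`j`, and sets all other penalties to zero. -/
def clusterInstance (F F₂ : Finset E) (j : I.Cluster F F₂) : PCSF V E ι :=
  I.restrict fun i => I.clusterOf F F₂ (I.s i) = j ∧ I.clusterOf F F₂ (I.t i) = j

end PCSF

end

/-! ## Reachability in spanned graphs -/

namespace CostGraph

variable {V E : Type*} {G : CostGraph V E}

/-! The solution `Fstar` is distributed among the clusters, and where it leaves a cluster it is
replaced by trees of `F`, which the clustering algorithm makes affordable.

Clustering is viewed as a colouring (`Clustering.ColourSplit`): each vertex spends its own potential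
on the growth of components containing it. When a set becomes inactive, all its vertices have spent
everything, and only on subsets of it. Two facts follow (`Clustering.Output.exists_family`). The
inactive sets separate the clusters, because an edge is pruned only when it is the last one leaving
such a set. And if an edge set `H` connects every vertex of a set `L` to the outside of an inactive
set containing it, then `H` crosses every set on which these vertices spent potential; since no edge
is overloaded, the total potential of `L` is at most the length of `H`.

Take for `L` the trees of `F` that `Fstar` connects in this way to the outside of an inactive set
around them. With potentials equal to lengths divided by ε, these trees have total length at most ε
times the length of `Fstar`. If `Fstar` connects two vertices whose trees are not in `L`, no
inactive set separates the trees, so they share a cluster. Hence each component of `Fstar` can be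
given to at most one cluster.

The solution for cluster `j` consists of the components given to `j` and the trees of `L` in `j`. An
unpaid pair inside `j` is connected by both `F` and `Fstar`: by its tree if that tree is in `L`,
otherwise by its component of `Fstar`. Summing over the clusters gives the bound. -/

theorem reachable_of_mem {F : Finset E} {e : E} (he : e ∈ F) {u v : V} (h : G.ends e = s(u, v)) :
    (G.span F).Reachable u v := by
  by_cases huv : u = v
  · rw [huv]
  · exact SimpleGraph.Adj.reachable
      ((SimpleGraph.fromRel_adj _ _ _).2 ⟨huv, Or.inl ⟨e, he, h⟩⟩)

/-- A property that is passed along the edges of `F` is passed along the components of `(V, F)`. -/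
theorem reachable_induction {F : Finset E} {P : V → Prop}
    (hP : ∀ e ∈ F, ∀ u v, G.ends e = s(u, v) → P u → P v) {u v : V}
    (h : (G.span F).Reachable u v) (hu : P u) : P v := by
  obtain ⟨w⟩ := h
  induction w with
  | nil => exact hu
  | cons hadj _ ih =>
    refine ih ?_
    rcases ((SimpleGraph.fromRel_adj _ _ _).1 hadj).2 with ⟨e, he, h⟩ | ⟨e, he, h⟩
    · exact hP e he _ _ h hu
    · exact hP e he _ _ (h.trans Sym2.eq_swap) hu

theorem reachable_of_forall {F F' : Finset E}
    (h : ∀ e ∈ F, ∀ u v, G.ends e = s(u, v) → (G.span F').Reachable u v) {u v : V}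
    (huv : (G.span F).Reachable u v) : (G.span F').Reachable u v :=
  reachable_induction (P := fun w => (G.span F').Reachable u w)
    (fun e he a b hab ha => ha.trans (h e he a b hab)) huv (SimpleGraph.Reachable.refl _)

theorem reachable_mono {F F' : Finset E} (h : F ⊆ F') {u v : V}
    (huv : (G.span F).Reachable u v) : (G.span F').Reachable u v :=
  reachable_of_forall (fun _ he _ _ hab => reachable_of_mem (h he) hab) huv

/-- Two vertices that are connected by `F`, but not without `e`, lie at different ends of `e`. -/
theorem reachable_erase {F : Finset E} {e : E} {x y : V} (he : G.ends e = s(x, y)) {u v : V}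
    (huv : (G.span F).Reachable u v) :
    (G.span (F.erase e)).Reachable u v ∨
      ((G.span (F.erase e)).Reachable u x ∧ (G.span (F.erase e)).Reachable y v) ∨
      ((G.span (F.erase e)).Reachable u y ∧ (G.span (F.erase e)).Reachable x v) := by
  refine reachable_induction (P := fun w => (G.span (F.erase e)).Reachable u w ∨
      ((G.span (F.erase e)).Reachable u x ∧ (G.span (F.erase e)).Reachable y w) ∨
      ((G.span (F.erase e)).Reachable u y ∧ (G.span (F.erase e)).Reachable x w)) ?_ huv
      (Or.inl (SimpleGraph.Reachable.refl _))
  intro f hf a b hab ha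
  by_cases hfe : f = e
  · subst hfe
    rw [he, Sym2.eq_iff] at hab
    rcases hab with ⟨rfl, rfl⟩ | ⟨rfl, rfl⟩
    · rcases ha with h | ⟨h, -⟩ | ⟨h, -⟩
      · exact Or.inr (Or.inl ⟨h, SimpleGraph.Reachable.refl _⟩)
      · exact Or.inr (Or.inl ⟨h, SimpleGraph.Reachable.refl _⟩)
      · exact Or.inl h
    · rcases ha with h | ⟨h, -⟩ | ⟨h, -⟩
      · exact Or.inr (Or.inr ⟨h, SimpleGraph.Reachable.refl _⟩)
      · exact Or.inl h
      · exact Or.inr (Or.inr ⟨h, SimpleGraph.Reachable.refl _⟩)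
  · have hR := reachable_of_mem (G := G) (Finset.mem_erase.2 ⟨hfe, hf⟩) hab
    rcases ha with h | ⟨h, h'⟩ | ⟨h, h'⟩
    · exact Or.inl (h.trans hR)
    · exact Or.inr (Or.inl ⟨h, h'.trans hR⟩)
    · exact Or.inr (Or.inr ⟨h, h'.trans hR⟩)

/-- Every edge set contains a forest with the same connected components. -/
theorem exists_isForest_subset (X : Finset E) :
    ∃ F ⊆ X, G.IsForest F ∧ ∀ u v, (G.span X).Reachable u v → (G.span F).Reachable u v := by
  induction X using Finset.strongInduction with
  | H X ih =>
    by_cases hX : G.IsForest X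
    · exact ⟨X, subset_rfl, hX, fun _ _ h => h⟩
    · simp only [IsForest] at hX
      push Not at hX
      obtain ⟨e, he, u, v, huv, hR⟩ := hX
      obtain ⟨F, hFX, hF, hFR⟩ := ih _ (Finset.erase_ssubset he)
      refine ⟨F, hFX.trans (Finset.erase_subset _ _), hF, fun a b hab => hFR a b ?_⟩
      refine reachable_of_forall (fun f hf c d hcd => ?_) hab
      by_cases hfe : f = e
      · subst hfe
        rw [huv, Sym2.eq_iff] at hcd
        rcases hcd with ⟨rfl, rfl⟩ | ⟨rfl, rfl⟩
        · exact hR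
        · exact hR.symm
      · exact reachable_of_mem (Finset.mem_erase.2 ⟨hfe, hf⟩) hcd

/-- A path in `F` stays in the component of its first vertex. This lets a single tree of `F` serve a
pair whose tree has been charged. -/
theorem reachable_treeEdges {F : Finset E} {u v : V} (h : (G.span F).Reachable u v) :
    (G.span (G.treeEdges F ((G.span F).connectedComponentMk u))).Reachable u v := by
  refine (reachable_induction (P := fun w => (G.span F).Reachable u w ∧
    (G.span (G.treeEdges F ((G.span F).connectedComponentMk u))).Reachable u w) ?_ h
      ⟨SimpleGraph.Reachable.refl _, SimpleGraph.Reachable.refl _⟩).2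
  rintro e he a b hab ⟨ha, ha'⟩
  have hb := ha.trans (reachable_of_mem he hab)
  refine ⟨hb, ha'.trans (reachable_of_mem ?_ hab)⟩
  simp only [treeEdges, Finset.mem_filter, hab, Sym2.mem_iff]
  refine ⟨he, ?_⟩
  rintro w (rfl | rfl)
  · exact SimpleGraph.ConnectedComponent.eq.2 ha.symm
  · exact SimpleGraph.ConnectedComponent.eq.2 hb.symm

/-- Distinct trees share no edge, since any one end of an edge determines its component. -/
theorem length_biUnion_treeEdges (F : Finset E) (L : Finset (G.span F).ConnectedComponent) :
    G.length (L.biUnion (G.treeEdges F)) = ∑ K ∈ L, G.length (G.treeEdges F K) := by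
  refine Finset.sum_biUnion fun K _ K' _ hne => Finset.disjoint_left.2 fun e he he' => hne ?_
  simp only [treeEdges, Finset.mem_filter] at he he'
  rw [← he.2 _ (Sym2.out_fst_mem _), ← he'.2 _ (Sym2.out_fst_mem _)]

theorem length_union_le (hcost : ∀ e, 0 ≤ G.cost e) (X Y : Finset E) :
    G.length (X ∪ Y) ≤ G.length X + G.length Y := by
  simp only [length]
  rw [← Finset.sum_union_inter]
  exact le_add_of_nonneg_right (Finset.sum_nonneg fun e _ => hcost e)

/-- If `H` connects a vertex contracted into `S` to a vertex contracted outside `S`, then an edge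
of `H` crosses `S` in the contracted graph. -/
theorem exists_crosses_contract {F H : Finset E} {S : Finset (G.span F).ConnectedComponent}
    {u v : V} (h : (G.span H).Reachable u v) (hu : (G.span F).connectedComponentMk u ∈ S)
    (hv : (G.span F).connectedComponentMk v ∉ S) : ∃ e ∈ H, (G.contract F).Crosses e S := by
  by_contra hcon
  push Not at hcon
  refine hv (reachable_induction (P := fun w => (G.span F).connectedComponentMk w ∈ S) ?_ h hu)
  intro e he a b hab ha
  by_contra hb
  refine hcon e he ⟨_, ha, _, hb, ?_⟩
  simp [contract, hab]

end CostGraph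

/-! ## The dual solution built by prize-collecting clustering -/

namespace Clustering

variable {V E : Type*} [Fintype V]

/-- `r v` is the part of the potential of the vertex `v` that has not been spent yet, and `z S v`
the part that has been spent on the growth of `S`. -/
structure ColourSplit (φ : V → ℝ) (σ : State V E) (r : V → ℝ) (z : Finset V → V → ℝ) : Prop where
  rest_nonneg : ∀ v, 0 ≤ r v
  part_nonneg : ∀ S v, 0 ≤ z S v
  total : ∀ v, r v + ∑ S, z S v = φ v
  growth : ∀ S, σ.core.y S = ∑ v, z S v
  part_mem : ∀ S v, z S v ≠ 0 → v ∈ S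
  part_subset : ∀ S v, z S v ≠ 0 → ∀ C ∈ σ.core.comps, v ∈ C → S ⊆ C
  pot : ∀ C ∈ σ.core.comps, σ.core.pot C = ∑ v ∈ C, r v
  rest_inactive : ∀ S ∈ σ.inactive, ∀ v ∈ S, r v = 0
  part_inactive : ∀ S ∈ σ.inactive, ∀ v ∈ S, ∀ S', z S' v ≠ 0 → S' ⊆ S

/-- The components partition the vertex set, are connected, and each is active or has become
inactive. -/
structure Partitioned (G : CostGraph V E) (σ : State V E) : Prop where
  cover : ∀ v, ∃ C ∈ σ.core.comps, v ∈ C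
  unique : ∀ C ∈ σ.core.comps, ∀ D ∈ σ.core.comps, ∀ v ∈ C, v ∈ D → C = D
  active_subset : σ.core.active ⊆ σ.core.comps
  inactive_of_not_active : ∀ C ∈ σ.core.comps, C ∉ σ.core.active → C ∈ σ.inactive
  connected : ∀ C ∈ σ.core.comps, ∀ u ∈ C, ∀ v ∈ C, (G.span σ.core.forest).Reachable u v

/-- The invariant of the first stage. -/
structure Inv (G : CostGraph V E) (φ : V → ℝ) (σ : State V E) : Prop where
  partitioned : Partitioned G σ
  load_le : ∀ e, G.load σ.core.y e ≤ G.cost e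
  split : ∃ r z, ColourSplit φ σ r z

/-! ### The invariant holds throughout the first stage. -/

variable {G : CostGraph V E} {φ : V → ℝ}

theorem inv_init (hcost : ∀ e, 0 ≤ G.cost e) (hφ : ∀ v, 0 ≤ φ v) :
    Inv G φ (init φ : State V E) where
  partitioned :=
    { cover := fun v => ⟨{v}, by simp [init], by simp⟩
      unique := by
        simp only [init, Finset.mem_image, Finset.mem_univ, true_and]
        rintro _ ⟨a, rfl⟩ _ ⟨b, rfl⟩ v hv hv'
        rw [← Finset.mem_singleton.1 hv, ← Finset.mem_singleton.1 hv']
      active_subset := subset_rfl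
      inactive_of_not_active := fun C hC hC' => absurd hC hC'
      connected := by
        simp only [init, Finset.mem_image, Finset.mem_univ, true_and]
        rintro _ ⟨a, rfl⟩ u hu v hv
        rw [Finset.mem_singleton.1 hu, Finset.mem_singleton.1 hv] }
  load_le e := by simpa [init, CostGraph.load] using hcost e
  split := ⟨φ, fun _ _ => 0,
    { rest_nonneg := hφ
      part_nonneg := fun _ _ => le_rfl
      total := by simp
      growth := by simp [init]
      part_mem := by simp
      part_subset := by simp
      pot := by
        simp only [init, Finset.mem_image, Finset.mem_univ, true_and]
        rintro _ ⟨a, rfl⟩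
        simp [Finset.sum_filter]
      rest_inactive := by simp [init]
      part_inactive := by simp }⟩

/-- Growth is paid for by the vertices of a component in proportion to their remaining
potentials. -/
theorem inv_grow {σ : State V E} (hσ : Inv G φ σ) {Δ : ℝ} (hΔ : 0 ≤ Δ)
    (hf : (σ.core.grow Δ).Feasible G) : Inv G φ { σ with core := σ.core.grow Δ } := by
  obtain ⟨hp, -, r, z, h⟩ := hσ
  have hpot : ∀ S ∈ σ.core.active, Δ ≤ σ.core.pot S := by
    intro S hS
    have h0 := hf.2 S hS
    simp only [GrowState.grow, hS, if_true] at h0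
    linarith
  -- The amount that `v` adds to the growth of `S`. The factor is at most 1 because the growth is
  -- feasible, so no vertex overdraws.
  set d : Finset V → V → ℝ := fun S v =>
    if S ∈ σ.core.active ∧ v ∈ S then r v * (Δ / σ.core.pot S) else 0 with hd
  have hd_nonneg : ∀ S v, 0 ≤ d S v := by
    intro S v
    simp only [hd]
    split_ifs with hS
    · exact mul_nonneg (h.rest_nonneg v) (div_nonneg hΔ (hΔ.trans (hpot S hS.1)))
    · exact le_rfl
  have hd_mem : ∀ S v, d S v ≠ 0 → S ∈ σ.core.active ∧ v ∈ S ∧ r v ≠ 0 := by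
    intro S v hS
    simp only [hd] at hS
    split_ifs at hS with hS'
    · exact ⟨hS'.1, hS'.2, left_ne_zero_of_mul hS⟩
    · exact absurd rfl hS
  have hd_comp : ∀ v, ∀ C ∈ σ.core.comps, v ∈ C → ∑ S, d S v = d C v := by
    intro v C hC hv
    refine Finset.sum_eq_single C (fun S _ hSC => ?_) (by simp)
    by_contra hne
    obtain ⟨hS, hvS, -⟩ := hd_mem S v hne
    exact hSC (hp.unique S (hp.active_subset hS) C hC v hvS hv)
  have hd_le : ∀ v, ∑ S, d S v ≤ r v := by
    intro v
    obtain ⟨C, hC, hv⟩ := hp.cover v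
    rw [hd_comp v C hC hv]
    simp only [hd]
    split_ifs with hS
    · exact mul_le_of_le_one_right (h.rest_nonneg v)
        (div_le_one_of_le₀ (hpot C hS.1) (hΔ.trans (hpot C hS.1)))
    · exact h.rest_nonneg v
  have hd_sum : ∀ S ∈ σ.core.active, ∑ v ∈ S, d S v = Δ := by
    intro S hS
    have : ∑ v ∈ S, d S v = (∑ v ∈ S, r v) * (Δ / σ.core.pot S) := by
      rw [Finset.sum_mul]
      exact Finset.sum_congr rfl fun v hv => by simp [hd, hS, hv]
    rw [this, ← h.pot S (hp.active_subset hS)]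
    -- Potential 0 forces `Δ = 0`, so the division by zero in `d` is harmless.
    rcases eq_or_ne (σ.core.pot S) 0 with h0 | h0
    · have := hpot S hS
      rw [h0, zero_mul]
      linarith
    · field_simp
  have hd_outside : ∀ S, ∑ v, d S v = ∑ v ∈ S, d S v := by
    intro S
    refine (Finset.sum_subset (Finset.subset_univ _) fun v _ hv => ?_).symm
    by_contra hne
    exact hv (hd_mem S v hne).2.1
  have hd_inactive : ∀ S ∉ σ.core.active, ∀ v, d S v = 0 := fun S hS v => by simp [hd, hS]
  have hz : ∀ S v, z S v + d S v ≠ 0 → z S v ≠ 0 ∨ d S v ≠ 0 := by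
    intro S v hne
    by_contra hcon
    push Not at hcon
    exact hne (by rw [hcon.1, hcon.2, add_zero])
  refine ⟨⟨hp.cover, hp.unique, hp.active_subset, hp.inactive_of_not_active, hp.connected⟩, hf.1,
    fun v => r v - ∑ S, d S v, fun S v => z S v + d S v, ?_⟩
  constructor
  · exact fun v => sub_nonneg.2 (hd_le v)
  · exact fun S v => add_nonneg (h.part_nonneg S v) (hd_nonneg S v)
  · intro v
    rw [Finset.sum_add_distrib, ← h.total v]
    ring
  · intro S
    simp only [GrowState.grow, Finset.sum_add_distrib, ← h.growth S]
    split_ifs with hS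
    · rw [hd_outside, hd_sum S hS]
    · simp [hd_inactive S hS]
  · intro S v hne
    rcases hz S v hne with h1 | h1
    · exact h.part_mem S v h1
    · exact (hd_mem S v h1).2.1
  · intro S v hne C hC hv
    rcases hz S v hne with h1 | h1
    · exact h.part_subset S v h1 C hC hv
    · obtain ⟨hS, hvS, -⟩ := hd_mem S v h1
      exact (hp.unique S (hp.active_subset hS) C hC v hvS hv).subset
  · intro C hC
    have hsum : ∑ v ∈ C, ∑ S, d S v = ∑ v ∈ C, d C v :=
      Finset.sum_congr rfl fun v hv => hd_comp v C hC hv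
    simp only [GrowState.grow, Finset.sum_sub_distrib, hsum, ← h.pot C hC]
    split_ifs with hS
    · rw [hd_sum C hS]
    · simp [hd_inactive C hS]
  -- By now `S` may lie inside an active component; its vertices have nothing left, so they pay for
  -- no later growth.
  · intro S hS v hv
    have h0 := h.rest_inactive S hS v hv
    have := hd_le v
    have := Finset.sum_nonneg fun S (_ : S ∈ Finset.univ) => hd_nonneg S v
    linarith
  · intro S hS v hv S' hne
    rcases hz S' v hne with h1 | h1
    · exact h.part_inactive S hS v hv S' h1
    · exact absurd (h.rest_inactive S hS v hv) (hd_mem S' v h1).2.2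

/-- The colouring is kept unchanged: merging spends nothing, and the potentials of the two disjoint
parts add up. -/
theorem inv_merge {σ : State V E} (hσ : Inv G φ σ) {e : E} {S₁ S₂ : Finset V}
    (he : σ.core.EdgeEvent G e S₁ S₂) : Inv G φ { σ with core := σ.core.merge e S₁ S₂ } := by
  obtain ⟨hp, hload, r, z, h⟩ := hσ
  obtain ⟨h1, h2, hne, -, ⟨u, hu, v, hv, huv⟩, -⟩ := he
  have hdisj : Disjoint S₁ S₂ :=
    Finset.disjoint_left.2 fun w hw hw' => hne (hp.unique _ h1 _ h2 w hw hw')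
  -- Potential is spent only on subsets of current components, and the union is contained in neither
  -- part. So its growth is already 0, and resetting it changes nothing.
  have hz : ∀ w, z (S₁ ∪ S₂) w = 0 := by
    intro w
    by_contra hw
    rcases Finset.mem_union.1 (h.part_mem _ _ hw) with hw' | hw'
    · exact Finset.disjoint_left.1 hdisj
        (h.part_subset _ _ hw _ h1 hw' (Finset.mem_union_right _ hv)) hv
    · exact Finset.disjoint_left.1 hdisj hu
        (h.part_subset _ _ hw _ h2 hw' (Finset.mem_union_left _ hu))
  have hy : (σ.core.merge e S₁ S₂).y = σ.core.y := by
    refine Function.update_eq_self_iff.2 ?_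
    rw [h.growth]
    simp [hz]
  have hmem : ∀ C, C ∈ (σ.core.merge e S₁ S₂).comps →
      C = S₁ ∪ S₂ ∨ (C ∈ σ.core.comps ∧ C ≠ S₁ ∧ C ≠ S₂) := by
    intro C hC
    simpa [GrowState.merge] using hC
  have hunion : ∀ C ∈ σ.core.comps, C ≠ S₁ → C ≠ S₂ → ∀ w ∈ C, w ∉ S₁ ∪ S₂ := by
    intro C hC hC1 hC2 w hw hw'
    rcases Finset.mem_union.1 hw' with hw' | hw'
    · exact hC1 (hp.unique _ hC _ h1 w hw hw')
    · exact hC2 (hp.unique _ hC _ h2 w hw hw')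
  have hmono : ∀ a b, (G.span σ.core.forest).Reachable a b →
      (G.span (σ.core.merge e S₁ S₂).forest).Reachable a b :=
    fun a b hab => CostGraph.reachable_mono (Finset.subset_insert _ _) hab
  refine ⟨⟨?_, ?_, ?_, ?_, ?_⟩, by simpa only [hy] using hload, r, z, ?_⟩
  · intro w
    obtain ⟨C, hC, hw⟩ := hp.cover w
    by_cases hC1 : C = S₁
    · exact ⟨S₁ ∪ S₂, by simp [GrowState.merge], Finset.mem_union_left _ (hC1 ▸ hw)⟩
    by_cases hC2 : C = S₂
    · exact ⟨S₁ ∪ S₂, by simp [GrowState.merge], Finset.mem_union_right _ (hC2 ▸ hw)⟩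
    · exact ⟨C, by simp [GrowState.merge, hC, hC1, hC2], hw⟩
  · intro C hC D hD w hwC hwD
    rcases hmem C hC with rfl | ⟨hC, hC1, hC2⟩ <;> rcases hmem D hD with rfl | ⟨hD, hD1, hD2⟩
    · rfl
    · exact absurd hwC (hunion D hD hD1 hD2 w hwD)
    · exact absurd hwD (hunion C hC hC1 hC2 w hwC)
    · exact hp.unique C hC D hD w hwC hwD
  · exact Finset.insert_subset_insert _ (Finset.sdiff_subset_sdiff hp.active_subset subset_rfl)
  · intro C hC hCa
    rcases hmem C hC with rfl | ⟨hC, hC1, hC2⟩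
    · exact absurd (Finset.mem_insert_self _ _) hCa
    · refine hp.inactive_of_not_active C hC fun hCa' => hCa ?_
      simp [GrowState.merge, hCa', hC1, hC2]
  · intro C hC a ha b hb
    rcases hmem C hC with rfl | ⟨hC, -, -⟩
    · have huv' : (G.span (σ.core.merge e S₁ S₂).forest).Reachable u v :=
        CostGraph.reachable_of_mem (Finset.mem_insert_self _ _) huv
      have key : ∀ w ∈ S₁ ∪ S₂, (G.span (σ.core.merge e S₁ S₂).forest).Reachable u w := by
        intro w hw
        rcases Finset.mem_union.1 hw with hw | hw
        · exact hmono _ _ (hp.connected _ h1 u hu w hw)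
        · exact huv'.trans (hmono _ _ (hp.connected _ h2 v hv w hw))
      exact (key a ha).symm.trans (key b hb)
    · exact hmono _ _ (hp.connected C hC a ha b hb)
  · refine ⟨h.rest_nonneg, h.part_nonneg, h.total, by simpa only [hy] using h.growth, h.part_mem,
      ?_, ?_, h.rest_inactive, h.part_inactive⟩
    · intro S w hS C hC hw
      rcases hmem C hC with rfl | ⟨hC, -, -⟩
      · rcases Finset.mem_union.1 hw with hw | hw
        · exact (h.part_subset S w hS _ h1 hw).trans Finset.subset_union_left
        · exact (h.part_subset S w hS _ h2 hw).trans Finset.subset_union_right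
      · exact h.part_subset S w hS C hC hw
    · intro C hC
      rcases hmem C hC with rfl | ⟨hC, hC1, hC2⟩
      · simp [GrowState.merge, Finset.sum_union hdisj, h.pot _ h1, h.pot _ h2]
      · have hCne : C ≠ S₁ ∪ S₂ := by
          rintro rfl
          exact hunion _ hC hC1 hC2 u (Finset.mem_union_left _ hu) (Finset.mem_union_left _ hu)
        simp [GrowState.merge, Function.update_of_ne hCne, h.pot C hC]

/-- Nonnegative remainders with sum 0 all vanish, and what the vertices of a current component have
spent went to its subsets. -/
theorem inv_deactivate {σ : State V E} (hσ : Inv G φ σ) {S : Finset V}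
    (hS : σ.core.SpentEvent S) :
    Inv G φ { core := σ.core.deactivate S, inactive := insert S σ.inactive } := by
  obtain ⟨hp, hload, r, z, h⟩ := hσ
  have hSc := hp.active_subset hS.1
  refine ⟨⟨hp.cover, hp.unique, (Finset.erase_subset _ _).trans hp.active_subset, ?_,
    hp.connected⟩, hload, r, z, h.rest_nonneg, h.part_nonneg, h.total, h.growth, h.part_mem,
    h.part_subset, h.pot, ?_, ?_⟩
  · intro C hC hCa
    rcases eq_or_ne C S with rfl | hCS
    · exact Finset.mem_insert_self _ _
    · exact Finset.mem_insert_of_mem (hp.inactive_of_not_active C hC fun hCa' =>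
        hCa (Finset.mem_erase.2 ⟨hCS, hCa'⟩))
  · intro T hT v hv
    rcases Finset.mem_insert.1 hT with rfl | hT
    · have h0 := h.pot T hSc
      rw [hS.2] at h0
      exact (Finset.sum_eq_zero_iff_of_nonneg fun v _ => h.rest_nonneg v).1 h0.symm v hv
    · exact h.rest_inactive T hT v hv
  · intro T hT v hv S' hS'
    rcases Finset.mem_insert.1 hT with rfl | hT
    · exact h.part_subset S' v hS' T hSc hv
    · exact h.part_inactive T hT v hv S' hS'

theorem inv_of_reflTransGen (hcost : ∀ e, 0 ≤ G.cost e) (hφ : ∀ v, 0 ≤ φ v) {σ : State V E}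
    (h : Relation.ReflTransGen (Step G) (init φ) σ) : Inv G φ σ := by
  induction h with
  | refl => exact inv_init hcost hφ
  | tail _ hstep ih =>
    cases hstep with
    | merge Δ e S₁ S₂ hΔ hf he => exact inv_merge (inv_grow ih hΔ hf) he
    | deactivate Δ S hΔ hf hS => exact inv_deactivate (inv_grow ih hΔ hf) hS

/-! ### Pruning, and charging potentials to a crossing edge set. -/

/-- Vertices that `F` does not connect are separated by a member of `B`. -/
def SeparatedBy (G : CostGraph V E) (B : Finset (Finset V)) (F : Finset E) : Prop :=
  ∀ u v, ¬ (G.span F).Reachable u v → ∃ S ∈ B, (u ∈ S ∧ v ∉ S) ∨ (v ∈ S ∧ u ∉ S)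

/-- Without `e` no edge leaves `S`, so `S` is closed under reachability. Two vertices that the
deletion disconnects are still attached to opposite ends of `e`, hence lie on opposite sides of `S`.
-/
theorem SeparatedBy.pruneStep {B : Finset (Finset V)} {F F' : Finset E}
    (h : SeparatedBy G B F) (hstep : PruneStep G B F F') : SeparatedBy G B F' := by
  obtain ⟨S, hS, e, heq, rfl⟩ := hstep
  have he : e ∈ F ∧ G.Crosses e S := by
    have : e ∈ ({f ∈ F | G.Crosses f S} : Finset E) := by rw [heq]; simp
    simpa using this
  obtain ⟨x, hx, y, hy, hxy⟩ := he.2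
  have hcross : ∀ f ∈ F.erase e, ¬ G.Crosses f S := by
    intro f hf hf'
    have : f ∈ ({f ∈ F | G.Crosses f S} : Finset E) := by simp [Finset.mem_of_mem_erase hf, hf']
    rw [heq, Finset.mem_singleton] at this
    exact Finset.ne_of_mem_erase hf this
  have hclosed : ∀ a b, (G.span (F.erase e)).Reachable a b → a ∈ S → b ∈ S := by
    intro a b hab
    refine CostGraph.reachable_induction (fun f hf c d hcd hc => ?_) hab
    by_contra hd
    exact hcross f hf ⟨c, hc, d, hd, hcd⟩
  intro u v huv
  by_cases hF : (G.span F).Reachable u v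
  · refine ⟨S, hS, ?_⟩
    rcases CostGraph.reachable_erase hxy hF with h0 | ⟨h1, h2⟩ | ⟨h1, h2⟩
    · exact absurd h0 huv
    · exact Or.inl ⟨hclosed _ _ h1.symm hx, fun hv => hy (hclosed _ _ h2.symm hv)⟩
    · exact Or.inr ⟨hclosed _ _ h2 hx, fun hu => hy (hclosed _ _ h1 hu)⟩
  · exact h u v hF

/-- The length of `H` is at least the total potential of a set of vertices each of which lies in
an inactive component `S` such that `H` crosses all parts of `S` containing the vertex. -/
theorem Inv.sum_le_length {σ : State V E} (hσ : Inv G φ σ) {H : Finset E} {L : Finset V}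
    (hL : ∀ v ∈ L, ∃ S ∈ σ.inactive, v ∈ S ∧ ∀ S' ⊆ S, v ∈ S' → ∃ e ∈ H, G.Crosses e S') :
    ∑ v ∈ L, φ v ≤ G.length H := by
  obtain ⟨-, hload, r, z, h⟩ := hσ
  have hy : ∀ S, 0 ≤ σ.core.y S := fun S => by
    rw [h.growth]
    exact Finset.sum_nonneg fun v _ => h.part_nonneg S v
  calc ∑ v ∈ L, φ v = ∑ v ∈ L, ∑ S, z S v := by
        refine Finset.sum_congr rfl fun v hv => ?_
        obtain ⟨S, hS, hvS, -⟩ := hL v hv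
        rw [← h.total v, h.rest_inactive S hS v hvS, zero_add]
    _ = ∑ S, ∑ v ∈ L, z S v := Finset.sum_comm
    _ ≤ ∑ S, ∑ e ∈ H, if G.Crosses e S then σ.core.y S else 0 := by
        refine Finset.sum_le_sum fun S _ => ?_
        have hnonneg : ∀ e ∈ H, 0 ≤ if G.Crosses e S then σ.core.y S else 0 := by
          intro e _
          split_ifs
          · exact hy S
          · exact le_rfl
        by_cases hS : ∀ v ∈ L, z S v = 0
        · rw [Finset.sum_eq_zero hS]
          exact Finset.sum_nonneg hnonneg
        · push Not at hS
          obtain ⟨v, hv, hz⟩ := hS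
          -- As `v` spent on `S`, the set `S` is a part of `T` containing `v`, so `H` crosses it.
          -- One crossing edge covers the whole growth of `S`, hence all that `L` spent on it.
          obtain ⟨T, hT, hvT, hTH⟩ := hL v hv
          obtain ⟨e, he, heS⟩ := hTH S (h.part_inactive T hT v hvT S hz) (h.part_mem S v hz)
          calc ∑ v ∈ L, z S v ≤ ∑ v, z S v :=
                Finset.sum_le_sum_of_subset_of_nonneg (Finset.subset_univ _)
                  fun v _ _ => h.part_nonneg S v
            _ = if G.Crosses e S then σ.core.y S else 0 := by rw [if_pos heS, h.growth]
            _ ≤ _ := Finset.single_le_sum hnonneg he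
    _ = ∑ e ∈ H, G.load σ.core.y e := by
        rw [Finset.sum_comm]
        exact Finset.sum_congr rfl fun e _ => (Finset.sum_filter _ _).symm
    _ ≤ G.length H := Finset.sum_le_sum fun e _ => hload e

/-- The two properties of the clustering algorithm that its applications use: a family of sets that
separates the clusters, such that charging to the members of the family is possible. -/
theorem Output.exists_family {F₂ : Finset E} (hcost : ∀ e, 0 ≤ G.cost e) (hφ : ∀ v, 0 ≤ φ v)
    (h : Output G φ F₂) :
    ∃ B : Finset (Finset V), SeparatedBy G B F₂ ∧ ∀ (H : Finset E) (L : Finset V),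
      (∀ v ∈ L, ∃ S ∈ B, v ∈ S ∧ ∀ S' ⊆ S, v ∈ S' → ∃ e ∈ H, G.Crosses e S') →
        ∑ v ∈ L, φ v ≤ G.length H := by
  obtain ⟨σ, hrun, hactive, hprune, -⟩ := h
  have hσ := inv_of_reflTransGen hcost hφ hrun
  refine ⟨σ.inactive, ?_, fun H L hL => hσ.sum_le_length hL⟩
  induction hprune with
  | refl =>
    -- At the end of the first stage every component is inactive and connected, so the component of
    -- `u` separates.
    intro u v huv
    obtain ⟨C, hC, hu⟩ := hσ.partitioned.cover u
    exact ⟨C, hσ.partitioned.inactive_of_not_active C hC (by simp [hactive]), Or.inl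
      ⟨hu, fun hv => huv (hσ.partitioned.connected C hC u hu v hv)⟩⟩
  | tail _ hstep ih => exact ih.pruneStep hstep

end Clustering

/-! ## Distributing a solution among the clusters -/

namespace PCSF

variable {V E ι : Type*} [Fintype ι] (I : PCSF V E ι)

/-- Every edge set, forest or not, gives an upper bound on the optimum. -/
theorem opt_le (hcost : ∀ e, 0 ≤ I.cost e) (hpenalty : ∀ i, 0 ≤ I.penalty i) (X : Finset E)
    (paid : Finset ι) (hX : ∀ i ∉ paid, I.penalty i ≠ 0 → I.Connects X i) :
    I.opt ≤ I.payingCost X paid := by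
  obtain ⟨F, hFX, hF, hR⟩ := CostGraph.exists_isForest_subset (G := I.toCostGraph) X
  have hbdd : BddBelow {x | ∃ F : Finset E, I.IsForest F ∧ x = I.totalCost F} := by
    refine ⟨0, ?_⟩
    rintro _ ⟨F', -, rfl⟩
    exact add_nonneg (Finset.sum_nonneg fun e _ => hcost e)
      (Finset.sum_nonneg fun i _ => hpenalty i)
  refine (csInf_le hbdd ⟨F, hF, rfl⟩).trans (add_le_add ?_ ?_)
  · exact Finset.sum_le_sum_of_subset_of_nonneg hFX fun e _ _ => hcost e
  -- Pairs with penalty 0 may stay unconnected for free; they are dropped before comparing with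
  -- `paid`.
  · rw [← Finset.sum_filter_ne_zero]
    refine Finset.sum_le_sum_of_subset_of_nonneg (fun i hi => ?_) fun i _ _ => hpenalty i
    simp only [Finset.mem_filter, Finset.mem_univ, true_and] at hi
    by_contra hip
    exact hi.1 (hR _ _ (hX i hip hi.2))

end PCSF

/-- After exchanging the sums, each `c a` occurs at most once. It serves for the edges of `Fstar`,
the trees in `L` and the paid pairs. -/
theorem sum_sum_le_of_unique {α β : Type*} [Fintype β] (s : Finset α) (p : α → β → Prop)
    [∀ b, DecidablePred fun a => p a b] (c : α → ℝ) (hc : ∀ a, 0 ≤ c a) (hp : ∀ a ∈ s, ∀ b b', p a b → p a b' → b = b') :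
    ∑ b, ∑ a ∈ s with p a b, c a ≤ ∑ a ∈ s, c a := by
  simp only [Finset.sum_filter]
  rw [Finset.sum_comm]
  refine Finset.sum_le_sum fun a has => ?_
  by_cases ha : ∃ b, p a b
  · obtain ⟨b, hb⟩ := ha
    rw [Finset.sum_eq_single b (fun b' _ hne => if_neg fun hb' => hne (hp a has b' b hb' hb))
      (by simp), if_pos hb]
  · push Not at ha
    simp [ha, hc a]

/-! ### The solutions for the clusters and their total cost. -/

theorem theorem7 {V E ι : Type*} [Fintype V] [Fintype E] [Fintype ι]
    (I : PCSF V E ι)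
    (hcost : ∀ e, 0 ≤ I.cost e) (hpenalty : ∀ i, 0 ≤ I.penalty i)
    (ε : ℝ) (hε : 0 < ε)
    -- the forest returned by the primal-dual algorithm on the instance with scaled penalties
    (F : Finset E) (hF : PrimalDual.Output (I.scale (2 / ε)) F)
    -- the forest returned by the clustering algorithm after contracting the trees of `F`
    (F₂ : Finset E) (hF₂ : Clustering.Output (I.contract F) (I.treePotential ε F) F₂)
    -- a solution of the original instance that pays for all pairs separated by `F`
    (Fstar : Finset E) (paid : Finset ι) (hFstar : I.IsPayingSolution Fstar paid)
    (hpaid : ∀ i, ¬ I.Connects F i → i ∈ paid) :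
    ∑ j : I.Cluster F F₂, (I.clusterInstance F F₂ j).opt ≤
      (1 + ε) * I.payingCost Fstar paid := by

  have hφ : ∀ K, 0 ≤ I.treePotential ε F K := fun K =>
    mul_nonneg (by positivity) (Finset.sum_nonneg fun e _ => hcost e)
  obtain ⟨B, hsep, hcharge⟩ := hF₂.exists_family (G := I.contract F) hcost hφ
  set mk := (I.span F).connectedComponentMk with hmk
  -- the trees of `F` that `Fstar` connects to the outside of a set of the family `B`
  set L : Finset (I.span F).ConnectedComponent :=
    {K | ∃ S ∈ B, K ∈ S ∧ ∃ u v, mk u = K ∧ mk v ∉ S ∧ (I.span Fstar).Reachable u v} with hL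
  have hlength : ∑ K ∈ L, I.length (I.treeEdges F K) ≤ ε * I.length Fstar := by
    have h := hcharge Fstar L fun K hK => by
      obtain ⟨S, hS, hKS, u, v, rfl, hv, huv⟩ := (Finset.mem_filter.1 hK).2
      exact ⟨S, hS, hKS, fun S' hS' huS' =>
        CostGraph.exists_crosses_contract huv huS' fun hv' => hv (hS' hv')⟩
    simp only [PCSF.treePotential, ← Finset.mul_sum] at h
    rw [one_div_mul_eq_div, div_le_iff₀ hε, mul_comm] at h
    exact h
  -- A set of `B` separating the two trees would put the tree inside it into `L`.
  have hcluster : ∀ u v, (I.span Fstar).Reachable u v → mk u ∉ L → mk v ∉ L →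
      I.clusterOf F F₂ u = I.clusterOf F F₂ v := by
    intro u v huv hu hv
    by_contra hne
    obtain ⟨S, hS, h | h⟩ := hsep (mk u) (mk v) fun h =>
      hne (SimpleGraph.ConnectedComponent.eq.2 h)
    · exact hu (Finset.mem_filter.2
        ⟨Finset.mem_univ _, S, hS, h.1, u, v, rfl, h.2, huv⟩)
    · exact hv (Finset.mem_filter.2
        ⟨Finset.mem_univ _, S, hS, h.1, v, u, rfl, h.2, huv.symm⟩)
  -- `e` lies in a component of `Fstar` that contains a vertex of the cluster `j` outside `L`
  set p : E → I.Cluster F F₂ → Prop := fun e j =>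
    ∃ a b u, I.ends e = s(a, b) ∧ (I.span Fstar).Reachable a u ∧ mk u ∉ L ∧
      I.clusterOf F F₂ u = j with hp
  set q : (I.span F).ConnectedComponent → I.Cluster F F₂ → Prop := fun K j =>
    ((I.contract F).span F₂).connectedComponentMk K = j with hq
  set A : I.Cluster F F₂ → Finset E := fun j => {e ∈ Fstar | p e j} with hA
  set T : I.Cluster F F₂ → Finset E := fun j => {K ∈ L | q K j}.biUnion (I.treeEdges F) with hT
  -- All vertices outside `L` in the component of an edge share a cluster, so the edge is used for
  -- at most one `j`.
  have hAsum : ∑ j, I.length (A j) ≤ I.length Fstar := by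
    refine sum_sum_le_of_unique Fstar p I.cost hcost ?_
    rintro e he j j' ⟨a, b, u, hab, hau, hu, rfl⟩ ⟨a', b', u', hab', hau', hu', rfl⟩
    refine hcluster u u' (hau.symm.trans (SimpleGraph.Reachable.trans ?_ hau')) hu hu'
    rw [hab, Sym2.eq_iff] at hab'
    rcases hab' with ⟨rfl, rfl⟩ | ⟨rfl, rfl⟩
    · exact SimpleGraph.Reachable.refl _
    · exact CostGraph.reachable_of_mem he hab
  have hTsum : ∑ j, I.length (T j) ≤ ε * I.length Fstar := by
    simp only [hT, CostGraph.length_biUnion_treeEdges]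
    refine le_trans (sum_sum_le_of_unique L q (fun K => I.length (I.treeEdges F K))
      (fun K => Finset.sum_nonneg fun e _ => hcost e) ?_) hlength
    rintro K - j j' rfl rfl
    rfl
  set keep : ι → I.Cluster F F₂ → Prop := fun i j =>
    I.clusterOf F F₂ (I.s i) = j ∧ I.clusterOf F F₂ (I.t i) = j with hkeep
  have hpen : ∑ j, ∑ i ∈ paid, (I.clusterInstance F F₂ j).penalty i ≤ ∑ i ∈ paid, I.penalty i := by
    have h := sum_sum_le_of_unique paid keep I.penalty hpenalty ?_
    · simp only [Finset.sum_filter] at h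
      convert h
      simp only [PCSF.clusterInstance, PCSF.restrict, keep]
      congr
    rintro i - j j' ⟨h, -⟩ ⟨h', -⟩
    rw [← h, ← h']
  have hopt : ∀ j, (I.clusterInstance F F₂ j).opt ≤
      I.length (A j) + I.length (T j) + ∑ i ∈ paid, (I.clusterInstance F F₂ j).penalty i := by
    intro j
    refine (PCSF.opt_le (I.clusterInstance F F₂ j) hcost (fun i => ?_) (A j ∪ T j) paid
      fun i hi hne => ?_).trans
      (add_le_add_left (CostGraph.length_union_le (G := I.toCostGraph) hcost _ _) _)
    · simp only [PCSF.clusterInstance, PCSF.restrict]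
      split_ifs
      · exact hpenalty i
      · exact le_rfl
    · have hj : I.clusterOf F F₂ (I.s i) = j := by
        by_contra hj
        exact hne (if_neg fun h => hj h.1)
      have hstar : (I.span Fstar).Reachable (I.s i) (I.t i) := by
        by_contra h
        exact hi (hFstar.2 i h)
      have hconn : (I.span F).Reachable (I.s i) (I.t i) := by
        by_contra h
        exact hi (hpaid i h)
      change (I.span (A j ∪ T j)).Reachable (I.s i) (I.t i)
      -- If the tree of `s i` is in `L`, it belongs to `T j` and contains `t i`. Otherwise `s i`
      -- itself witnesses that its whole component of `Fstar` belongs to `A j`.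
      by_cases hsL : mk (I.s i) ∈ L
      · refine CostGraph.reachable_mono ?_ (CostGraph.reachable_treeEdges hconn)
        exact (Finset.subset_biUnion_of_mem (I.treeEdges F)
          (Finset.mem_filter.2 ⟨hsL, hj⟩)).trans Finset.subset_union_right
      · refine (CostGraph.reachable_induction (P := fun w => (I.span Fstar).Reachable (I.s i) w ∧
          (I.span (A j ∪ T j)).Reachable (I.s i) w) ?_ hstar
          ⟨SimpleGraph.Reachable.refl _, SimpleGraph.Reachable.refl _⟩).2
        rintro e he a b hab ⟨ha, ha'⟩
        refine ⟨ha.trans (CostGraph.reachable_of_mem he hab),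
          ha'.trans (CostGraph.reachable_of_mem (Finset.mem_union_left _ ?_) hab)⟩
        exact Finset.mem_filter.2 ⟨he, a, b, I.s i, hab, ha.symm, hsL, hj⟩
  calc ∑ j, (I.clusterInstance F F₂ j).opt
      ≤ ∑ j, (I.length (A j) + I.length (T j) +
          ∑ i ∈ paid, (I.clusterInstance F F₂ j).penalty i) := Finset.sum_le_sum fun j _ => hopt j
    _ = ∑ j, I.length (A j) + ∑ j, I.length (T j) +
          ∑ j, ∑ i ∈ paid, (I.clusterInstance F F₂ j).penalty i := by
        rw [Finset.sum_add_distrib, Finset.sum_add_distrib]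
    _ ≤ I.length Fstar + ε * I.length Fstar + ∑ i ∈ paid, I.penalty i :=
        add_le_add (add_le_add hAsum hTsum) hpen
    _ ≤ (1 + ε) * I.payingCost Fstar paid := by
        have : 0 ≤ ε * ∑ i ∈ paid, I.penalty i :=
          mul_nonneg hε.le (Finset.sum_nonneg fun i _ => hpenalty i)
        rw [PCSF.payingCost]
        linarith
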